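/- Let $(X,\mathcal B,\mu)$ be a nonatomic Lebesgue (standard Borel) probability space, and let $\mathrm{Aut}(X,\mu)$ be the group of nonsingular transformations of $(X,\mu)$ (bimeasurable bijections preserving the class of $\mu$-null sets), where transformations that agree almost everywhere are identified. Let $T\in\mathrm{Aut}(X,\mu)$ be ergodic, let $$[T]=\{R\in \mathrm{Aut}(X,\mu) : Rx\in\{T^nx\}_{n\in\mathbb Z}\ \text{for almost every } x\}$$ be its full group, and let $N[T]$ be the normalizer of $[T]$ in $\mathrm{Aut}(X,\mu)$. Assume that $T$ is of type II$_\infty$ (there is a $\sigma$-finite $T$-invariant measure $m$ equivalent to $\mu$ with $m(X)=\infty$) or of type III (there is no $\sigma$-finite $T$-invariant measure equivalent to $\mu$). Let $G$ be a countable discrete group with identity $e$, and let $(\gamma,c)$ be a cocycle crossed action of $G$ into $N[T]$, i.e. maps $\gamma:G\to N[T]$ and $c:G\times G\to[T]$ with $$\gamma_g\gamma_h=c(g,h)\gamma_{gh},\qquad \gamma_e=\mathrm{id},\qquad c(e,h)=c(g,e)=\mathrm{id}\qquad (g,h\in G).$$ Then $c$ is a coboundary: there exists a map $u:G\to[T]$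 with $u(e)=\mathrm{id}$ such that $${}_uc(g,h):=u(g)\,\gamma_g u(h)\gamma_g^{-1}\,c(g,h)\,u(gh)^{-1}=\mathrm{id}\qquad\text{for all } g,h\in G;$$ equivalently, ${}_u\gamma_g:=u(g)\gamma_g$ defines a genuine action of $G$ into $N[T]$, i.e. ${}_u\gamma_g\,{}_u\gamma_h={}_u\gamma_{gh}$ for all $g,h\in G$. -/

import Mathlib

open MeasureTheory

namespace FullGroup

/-- The group of nonsingular transformations of `(X, μ)`: bijections `f` of `X` such that `f` and
`f⁻¹` are measurable and map null sets to null sets. These are the pointwise representatives;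
identification modulo null sets is made in `Aut`. -/
def Nonsingular {X : Type*} [MeasurableSpace X] (μ : Measure X) : Subgroup (Equiv.Perm X) where
  carrier := {f | Measure.QuasiMeasurePreserving (⇑f) μ μ ∧
    Measure.QuasiMeasurePreserving (⇑f⁻¹) μ μ}
  mul_mem' := by
    rintro f g ⟨hf, hf'⟩ ⟨hg, hg'⟩
    refine ⟨hf.comp hg, ?_⟩
    rw [mul_inv_rev]
    exact hg'.comp hf'
  one_mem' := ⟨Measure.QuasiMeasurePreserving.id μ, by
    rw [inv_one]; exact Measure.QuasiMeasurePreserving.id μ⟩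
  inv_mem' := by
    rintro f ⟨hf, hf'⟩
    exact ⟨hf', by rwa [inv_inv]⟩

/-- The nonsingular transformations that are almost everywhere equal to the identity. -/
def aeTrivial {X : Type*} [MeasurableSpace X] (μ : Measure X) : Subgroup (Nonsingular μ) where
  carrier := {f | ∀ᵐ x ∂μ, (f : Equiv.Perm X) x = x}
  mul_mem' := by
    intro f g hf hg
    filter_upwards [hg, g.2.1.ae hf] with x hx hx'
    change (f : Equiv.Perm X) ((g : Equiv.Perm X) x) = x
    rw [hx', hx]
  one_mem' := by
    change ∀ᵐ x ∂μ, (1 : Equiv.Perm X) x = x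
    exact Filter.Eventually.of_forall fun _ => rfl
  inv_mem' := by
    intro f hf
    have hf' : ∀ᵐ x ∂μ, (f : Equiv.Perm X) x = x := hf
    change ∀ᵐ x ∂μ, (f : Equiv.Perm X)⁻¹ x = x
    filter_upwards [hf'] with x hx
    rw [Equiv.Perm.inv_eq_iff_eq, hx]

instance aeTrivial_normal {X : Type*} [MeasurableSpace X] (μ : Measure X) :
    (aeTrivial μ).Normal where
  conj_mem := by
    intro f hf g
    filter_upwards [g.2.2.ae hf] with x hx
    change (g : Equiv.Perm X) ((f : Equiv.Perm X) ((g : Equiv.Perm X)⁻¹ x)) = x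
    rw [hx]
    exact Equiv.apply_symm_apply _ x

/-- `Aut(X, μ)`: the group of nonsingular transformations modulo equality almost everywhere. -/
abbrev Aut {X : Type*} [MeasurableSpace X] (μ : Measure X) : Type _ :=
  Nonsingular μ ⧸ aeTrivial μ

/-- The nonsingular transformations `R` such that `R x` lies in the orbit `{Tⁿ x | n ∈ ℤ}` for
almost every `x`. -/
def orbitPreserving {X : Type*} [MeasurableSpace X] {μ : Measure X} (T : Nonsingular μ) :
    Subgroup (Nonsingular μ) where
  carrier := {R | ∀ᵐ x ∂μ, ∃ n : ℤ, (R : Equiv.Perm X) x = ((T : Equiv.Perm X) ^ n) x}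
  mul_mem' := by
    intro R S hR hS
    filter_upwards [hS, S.2.1.ae hR] with x hx hx'
    obtain ⟨n, hn⟩ := hx
    obtain ⟨k, hk⟩ := hx'
    refine ⟨k + n, ?_⟩
    change (R : Equiv.Perm X) ((S : Equiv.Perm X) x) = _
    rw [hk, hn, zpow_add, Equiv.Perm.mul_apply]
  one_mem' := by
    change ∀ᵐ x ∂μ, ∃ n : ℤ, (1 : Equiv.Perm X) x = ((T : Equiv.Perm X) ^ n) x
    exact Filter.Eventually.of_forall fun x => ⟨0, by simp⟩
  inv_mem' := by
    intro R hR
    filter_upwards [R.2.2.ae hR] with x hx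
    obtain ⟨n, hn⟩ := hx
    refine ⟨-n, ?_⟩
    change (R : Equiv.Perm X)⁻¹ x = _
    replace hn : x = ((T : Equiv.Perm X) ^ n) ((R : Equiv.Perm X)⁻¹ x) :=
      (Equiv.apply_symm_apply (R : Equiv.Perm X) x).symm.trans hn
    rw [zpow_neg, eq_comm, Equiv.Perm.inv_eq_iff_eq]
    exact hn

/-- The full group `[T]`, as a subgroup of `Aut(X, μ)`. -/
def fullGroup {X : Type*} [MeasurableSpace X] {μ : Measure X} (T : Nonsingular μ) :
    Subgroup (Aut μ) :=
  (orbitPreserving T).map (QuotientGroup.mk' (aeTrivial μ))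

/-- `N[T]`, the normalizer of the full group `[T]` in `Aut(X, μ)`. -/
def fullNormalizer {X : Type*} [MeasurableSpace X] {μ : Measure X} (T : Nonsingular μ) :
    Subgroup (Aut μ) :=
  Subgroup.normalizer (fullGroup T : Set (Aut μ))

/-- `T` is ergodic: every `T`-invariant measurable set is null or conull. -/
def IsErgodic {X : Type*} [MeasurableSpace X] {μ : Measure X} (T : Nonsingular μ) : Prop :=
  QuasiErgodic (⇑(T : Equiv.Perm X)) μ

/-- `m` is a σ-finite `T`-invariant measure equivalent to `μ`. -/
structure IsInvariantMeasure {X : Type*} [MeasurableSpace X] {μ : Measure X} (T : Nonsingular μ)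
    (m : Measure X) : Prop where
  sigmaFinite : SigmaFinite m
  abs_cont : m ≪ μ
  abs_cont' : μ ≪ m
  invariant : MeasurePreserving (⇑(T : Equiv.Perm X)) m m

/-- Type II_∞ (for an ergodic `T` on a nonatomic space): there is an infinite σ-finite
`T`-invariant measure equivalent to `μ`. -/
def IsTypeIIInfinite {X : Type*} [MeasurableSpace X] {μ : Measure X} (T : Nonsingular μ) : Prop :=
  ∃ m : Measure X, IsInvariantMeasure T m ∧ m Set.univ = ⊤

/-- Type III (for an ergodic `T`): there is no σ-finite `T`-invariant measure equivalent to `μ`. -/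
def IsTypeIII {X : Type*} [MeasurableSpace X] {μ : Measure X} (T : Nonsingular μ) : Prop :=
  ¬ ∃ m : Measure X, IsInvariantMeasure T m

/-- A normalized 1-cochain `v : G → [T]`. -/
structure IsNormalizedCochain {X G : Type*} [MeasurableSpace X] [Group G] {μ : Measure X}
    (T : Nonsingular μ) (v : G → Aut μ) : Prop where
  mem_fullGroup : ∀ g, v g ∈ fullGroup T
  map_one : v 1 = 1

/-- `(α, c)` is a cocycle crossed action of `G` into `N[T]`. -/
structure IsCocycleCrossedAction {X G : Type*} [MeasurableSpace X] [Group G] {μ : Measure X}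
    (T : Nonsingular μ) (α : G → Aut μ) (c : G → G → Aut μ) : Prop where
  mem_fullNormalizer : ∀ g, α g ∈ fullNormalizer T
  mem_fullGroup : ∀ g h, c g h ∈ fullGroup T
  mul_eq : ∀ g h, α g * α h = c g h * α (g * h)
  map_one : α 1 = 1
  one_left : ∀ h, c 1 h = 1
  one_right : ∀ g, c g 1 = 1

/-- `α` is a (genuine) action of `G` into `N[T]`: a cocycle crossed action with trivial cocycle. -/
def IsAction {X G : Type*} [MeasurableSpace X] [Group G] {μ : Measure X}
    (T : Nonsingular μ) (α : G → Aut μ) : Prop :=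
  IsCocycleCrossedAction T α (fun _ _ => 1)

/-- The perturbed map `(ᵥα)_g = v(g) α_g`. -/
def perturbMap {X G : Type*} [MeasurableSpace X] [Group G] {μ : Measure X}
    (v α : G → Aut μ) : G → Aut μ :=
  fun g => v g * α g

/-- The perturbed cocycle `(ᵥc)(g, h) = v(g) (α_g v(h) α_g⁻¹) c(g, h) v(gh)⁻¹`. -/
def perturbCocycle {X G : Type*} [MeasurableSpace X] [Group G] {μ : Measure X}
    (v α : G → Aut μ) (c : G → G → Aut μ) : G → G → Aut μ :=
  fun g h => v g * (α g * v h * (α g)⁻¹) * c g h * (v (g * h))⁻¹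

end FullGroup

/-!
The argument is pointwise and rests on two facts.

*The space absorbs `G`.* There are a conull Borel set `Y`, invariant under any prescribed countable
group, and a Borel bijection `e : Y × G ≃ Y` with `e (y, h)` in the `T`-orbit of `y`
(`IsErgodic.exists_measurableEquiv_prod`). The source of this infinitude is Hopf's theorem. Take the
limit, along an ultrafilter, of the Cesàro means of the translates of `μ`: it is finitely additive
and invariant, and its countably additive part is a finite invariant measure `ν ≪ μ`
(`measurePreserving_cesaroMeasure`). Types II_∞ and III do not allow `ν ≠ 0`, and `ν = 0` yields a
set of positive measure whose translates become arbitrarily small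
(`IsErgodic.exists_measure_preimage_lt`). Such a set contains a weakly wandering set `W` of positive
measure, one with infinitely many disjoint translates (`exists_weaklyWandering`). By ergodicity the
translates of `W` cover a conull set `Y`, so `Y × G` injects into the disjoint translates of `W`,
and a Borel Schröder–Bernstein argument gives `e`.

*Crossed actions become actions on `Y × G`.* Left translation by `g` on the second coordinate is a
genuine action on `Y × G`. Transported to `Y` by `k (y, h) = e (γ_h y, h)`, it becomes a genuine
action `σ` on `Y`, and `σ_g` sends `k (y, h)` to `k (y, gh)`; up to `T`-orbits this is
`γ_h y ↦ γ_{gh} y`, that is, the map `γ_{gh} γ_h⁻¹ = c(g, h)⁻¹ γ_g`. Hence `σ_g γ_g⁻¹ ∈ [T]`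
(`IsCocycleCrossedAction.exists_hom`), and `u(g) = σ_g γ_g⁻¹` is the required cochain.
-/

namespace FullGroup

open Filter Set Topology
open scoped ENNReal

/-! ### Cesàro limits of sequences of measures -/

section CesaroLimit

variable {X : Type*} [MeasurableSpace X]

/-- The `N`-th Cesàro mean of the numbers `M n s`. It is `0` for `N = 0`, since `⊤ * 0 = 0`. -/
noncomputable def cesaroMean (M : ℕ → Measure X) (s : Set X) (N : ℕ) : ℝ≥0∞ :=
  (N : ℝ≥0∞)⁻¹ * ∑ n ∈ Finset.range N, M n s

/-- The limit of the Cesàro means of `M n s` along a fixed nonprincipal ultrafilter. It exists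
because `[0, ∞]` is compact, and it is finitely additive on measurable sets. It is defined on all
subsets, so that it can be fed to `OuterMeasure.ofFunction`. -/
noncomputable def cesaroLimit (M : ℕ → Measure X) (s : Set X) : ℝ≥0∞ :=
  ((hyperfilter ℕ).map (cesaroMean M s)).lim

variable (M : ℕ → Measure X)

theorem tendsto_cesaroLimit (s : Set X) :
    Tendsto (cesaroMean M s) (hyperfilter ℕ : Filter ℕ) (𝓝 (cesaroLimit M s)) :=
  ((hyperfilter ℕ).map (cesaroMean M s)).le_nhds_lim

theorem cesaroMean_congr {s t : Set X} (h : ∀ n, M n s = M n t) :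
    cesaroMean M s = cesaroMean M t := by
  funext N
  simp only [cesaroMean, h]

theorem cesaroLimit_congr {s t : Set X} (h : ∀ n, M n s = M n t) :
    cesaroLimit M s = cesaroLimit M t := by
  rw [cesaroLimit, cesaroLimit, cesaroMean_congr M h]

theorem cesaroLimit_mono {s t : Set X} (h : s ⊆ t) : cesaroLimit M s ≤ cesaroLimit M t := by
  refine le_of_tendsto_of_tendsto' (tendsto_cesaroLimit M s) (tendsto_cesaroLimit M t) fun N => ?_
  unfold cesaroMean
  gcongr

theorem cesaroLimit_eq_zero {s : Set X} (h : ∀ n, M n s = 0) : cesaroLimit M s = 0 := by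
  refine tendsto_nhds_unique (tendsto_cesaroLimit M s) ?_
  have : cesaroMean M s = fun _ => 0 := by
    funext N
    simp [cesaroMean, h]
  rw [this]
  exact tendsto_const_nhds

theorem cesaroLimit_inter_add_diff (t : Set X) {s : Set X} (hs : MeasurableSet s) :
    cesaroLimit M (t ∩ s) + cesaroLimit M (t \ s) = cesaroLimit M t := by
  refine tendsto_nhds_unique
    ((tendsto_cesaroLimit M (t ∩ s)).add (tendsto_cesaroLimit M (t \ s))) ?_
  refine (tendsto_cesaroLimit M t).congr fun N => ?_
  rw [cesaroMean, cesaroMean, cesaroMean, ← mul_add, ← Finset.sum_add_distrib]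
  simp only [measure_inter_add_sdiff t hs]

theorem cesaroLimit_union_le (s t : Set X) :
    cesaroLimit M (s ∪ t) ≤ cesaroLimit M s + cesaroLimit M t := by
  refine le_of_tendsto_of_tendsto' (tendsto_cesaroLimit M _)
    ((tendsto_cesaroLimit M s).add (tendsto_cesaroLimit M t)) fun N => ?_
  rw [cesaroMean, cesaroMean, cesaroMean, ← mul_add, ← Finset.sum_add_distrib]
  gcongr
  exact measure_union_le _ _

theorem cesaroLimit_accumulate_le (t : ℕ → Set X) (N : ℕ) :
    cesaroLimit M (accumulate t N) ≤ ∑ i ∈ Finset.range (N + 1), cesaroLimit M (t i) := by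
  induction N with
  | zero => simp
  | succ N ih =>
    rw [accumulate_succ, Finset.sum_range_succ]
    exact (cesaroLimit_union_le M _ _).trans (by gcongr)

theorem le_cesaroLimit {s : Set X} {ε : ℝ≥0∞} (h : ∀ n, ε ≤ M n s) : ε ≤ cesaroLimit M s := by
  refine ge_of_tendsto (tendsto_cesaroLimit M s) ?_
  filter_upwards [Nat.hyperfilter_le_atTop (eventually_ge_atTop 1)] with N hN
  calc ε = (N : ℝ≥0∞)⁻¹ * ∑ n ∈ Finset.range N, ε := by
        rw [Finset.sum_const, Finset.card_range, nsmul_eq_mul, ← mul_assoc,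
          ENNReal.inv_mul_cancel (by exact_mod_cast (by omega : N ≠ 0)) (by simp), one_mul]
    _ ≤ _ := by
        unfold cesaroMean
        gcongr
        exact h _

theorem cesaroLimit_le {s : Set X} {C : ℝ≥0∞} (h : ∀ n, M n s ≤ C) : cesaroLimit M s ≤ C := by
  refine le_of_tendsto (tendsto_cesaroLimit M s) ?_
  filter_upwards [Nat.hyperfilter_le_atTop (eventually_ge_atTop 1)] with N hN
  calc cesaroMean M s N ≤ (N : ℝ≥0∞)⁻¹ * ∑ n ∈ Finset.range N, C := by
        unfold cesaroMean
        gcongr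
        exact h _
    _ = C := by
        rw [Finset.sum_const, Finset.card_range, nsmul_eq_mul, ← mul_assoc,
          ENNReal.inv_mul_cancel (by exact_mod_cast (by omega : N ≠ 0)) (by simp), one_mul]

/-- Cesàro limits do not see a shift of the sequence of measures. -/
theorem cesaroLimit_eq_of_shift [∀ n, IsProbabilityMeasure (M n)] {s t : Set X}
    (h : ∀ n, M n s = M (n + 1) t) : cesaroLimit M s = cesaroLimit M t := by
  have hzero (f : ℕ → ℝ≥0∞) (hf : ∀ N, f N ≤ 1) :
      Tendsto (fun N : ℕ => (N : ℝ≥0∞)⁻¹ * f N) (hyperfilter ℕ : Filter ℕ) (𝓝 0) := by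
    refine tendsto_of_tendsto_of_tendsto_of_le_of_le tendsto_const_nhds
      (ENNReal.tendsto_inv_nat_nhds_zero.mono_left Nat.hyperfilter_le_atTop)
      (fun N => zero_le) fun N => ?_
    exact mul_le_of_le_one_right' (hf N)
  have h1 := (tendsto_cesaroLimit M s).add (hzero (fun _ => M 0 t) fun _ => prob_le_one)
  have h2 := (tendsto_cesaroLimit M t).add (hzero (fun N => M N t) fun _ => prob_le_one)
  rw [add_zero] at h1 h2
  refine tendsto_nhds_unique h1 (h2.congr fun N => ?_)
  rw [cesaroMean, cesaroMean, ← mul_add, ← mul_add, ← Finset.sum_range_succ,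
    Finset.sum_range_succ', Finset.sum_congr rfl fun n _ => h n]

/-- The countably additive part of `cesaroLimit M`: the largest measure below it on
measurable sets. -/
noncomputable def cesaroMeasure (M : ℕ → Measure X) : Measure X :=
  (OuterMeasure.ofFunction (cesaroLimit M)
    (cesaroLimit_eq_zero M fun _ => measure_empty)).toMeasure fun _ hs =>
      OuterMeasure.ofFunction_caratheodory fun t => (cesaroLimit_inter_add_diff M t hs).le

theorem cesaroMeasure_apply {s : Set X} (hs : MeasurableSet s) :
    cesaroMeasure M s = ⨅ (t : ℕ → Set X) (_ : s ⊆ ⋃ i, t i), ∑' i, cesaroLimit M (t i) := by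
  rw [cesaroMeasure, toMeasure_apply _ _ hs, OuterMeasure.ofFunction_apply]

theorem cesaroMeasure_le {s : Set X} (hs : MeasurableSet s) :
    cesaroMeasure M s ≤ cesaroLimit M s := by
  rw [cesaroMeasure, toMeasure_apply _ _ hs]
  exact OuterMeasure.ofFunction_le s

theorem isFiniteMeasure_cesaroMeasure [∀ n, IsProbabilityMeasure (M n)] :
    IsFiniteMeasure (cesaroMeasure M) :=
  ⟨(cesaroMeasure_le M .univ).trans_lt
    ((cesaroLimit_le M fun _ => prob_le_one).trans_lt ENNReal.one_lt_top)⟩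

theorem cesaroMeasure_absolutelyContinuous {μ : Measure X} (h : ∀ n, M n ≪ μ) :
    cesaroMeasure M ≪ μ := by
  refine Measure.AbsolutelyContinuous.mk fun s hs h0 => ?_
  exact le_antisymm ((cesaroMeasure_le M hs).trans
    (cesaroLimit_eq_zero M fun n => h n h0).le) zero_le

theorem cesaroMeasure_preimage_le [∀ n, IsProbabilityMeasure (M n)] {f : X → X}
    (hf : Measurable f) (h : ∀ n s, M n (f ⁻¹' s) = M (n + 1) s) {s : Set X}
    (hs : MeasurableSet s) : cesaroMeasure M (f ⁻¹' s) ≤ cesaroMeasure M s := by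
  rw [cesaroMeasure_apply M hs, cesaroMeasure_apply M (hf hs)]
  refine le_iInf₂ fun t ht => ?_
  refine iInf₂_le_of_le (fun i => f ⁻¹' t i) ?_ ?_
  · rw [← preimage_iUnion]
    exact preimage_mono ht
  · exact (tsum_congr fun i => cesaroLimit_eq_of_shift M fun n => h n (t i)).le

theorem measurePreserving_cesaroMeasure [∀ n, IsProbabilityMeasure (M n)] {f : X → X}
    (hf : Measurable f) (h : ∀ n s, M n (f ⁻¹' s) = M (n + 1) s) :
    MeasurePreserving f (cesaroMeasure M) (cesaroMeasure M) := by
  have := isFiniteMeasure_cesaroMeasure M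
  refine ⟨hf, ?_⟩
  have := Measure.isFiniteMeasure_map (cesaroMeasure M) f
  -- Two finite measures of the same total mass, one below the other, are equal.
  refine Measure.eq_of_le_of_measure_univ_eq (Measure.le_iff.2 fun s hs => ?_) ?_
  · rw [Measure.map_apply hf hs]
    exact cesaroMeasure_preimage_le M hf h hs
  · rw [Measure.map_apply hf .univ, preimage_univ]

/-- If the countably additive part of the Cesàro limit vanishes, then the Cesàro limit is small on
sets whose complement is small. -/
theorem exists_cesaroLimit_lt (h0 : cesaroMeasure M univ = 0) (μ : Measure X) [IsFiniteMeasure μ]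
    {ε δ : ℝ≥0∞} (hε : ε ≠ 0) (hδ : δ ≠ 0) :
    ∃ C, MeasurableSet C ∧ μ Cᶜ < δ ∧ cesaroLimit M C < ε := by
  rw [cesaroMeasure_apply M .univ] at h0
  have hlt := (h0.trans_lt (pos_iff_ne_zero.2 hε))
  simp only [iInf_lt_iff] at hlt
  obtain ⟨t, ht, hsum⟩ := hlt
  -- Measurable hulls of the members of the cover, for all the measures `M n` at once.
  choose t' htt' ht'm ht'eq using fun i =>
    OuterMeasure.exists_measurable_superset_forall_eq_trim (fun n => (M n).toOuterMeasure) (t i)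
  have heq (i : ℕ) : cesaroLimit M (t' i) = cesaroLimit M (t i) :=
    cesaroLimit_congr M fun n => by
      have := ht'eq i n
      rwa [Measure.trimmed] at this
  have hcover : ⋃ i, t' i = univ := univ_subset_iff.1 (ht.trans (iUnion_mono htt'))
  have hmeas (N : ℕ) : MeasurableSet (accumulate t' N) :=
    MeasurableSet.biUnion (to_countable _) fun i _ => ht'm i
  have hlim : Tendsto (fun N => μ (accumulate t' N)ᶜ) atTop (𝓝 0) := by
    have hanti : Antitone fun N => (accumulate t' N)ᶜ :=
      fun a b hab => compl_subset_compl.2 (monotone_accumulate hab)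
    have := tendsto_measure_iInter_atTop (μ := μ) (fun N => (hmeas N).compl.nullMeasurableSet)
      hanti ⟨0, measure_ne_top _ _⟩
    rwa [← compl_iUnion, iUnion_accumulate, hcover, compl_univ, measure_empty] at this
  obtain ⟨N, hN⟩ := (hlim.eventually (gt_mem_nhds (pos_iff_ne_zero.2 hδ))).exists
  refine ⟨accumulate t' N, hmeas N, hN, ?_⟩
  calc cesaroLimit M (accumulate t' N) ≤ ∑ i ∈ Finset.range (N + 1), cesaroLimit M (t' i) :=
        cesaroLimit_accumulate_le M t' N
    _ = ∑ i ∈ Finset.range (N + 1), cesaroLimit M (t i) := Finset.sum_congr rfl fun i _ => heq i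
    _ ≤ ∑' i, cesaroLimit M (t i) := ENNReal.sum_le_tsum _
    _ < ε := hsum

/-- If the Cesàro limit is purely finitely additive, then it vanishes on a set of positive
measure, along which the measures `M n` are therefore not bounded below. -/
theorem exists_measure_lt_of_cesaroMeasure_eq_zero (h0 : cesaroMeasure M univ = 0)
    (μ : Measure X) [IsFiniteMeasure μ] (hμ : μ ≠ 0) :
    ∃ B, MeasurableSet B ∧ μ B ≠ 0 ∧ ∀ ε : ℝ≥0∞, ε ≠ 0 → ∃ n, M n B < ε := by
  obtain ⟨δ, hδ, hδsum⟩ := ENNReal.exists_pos_sum_of_countable'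
    (Measure.measure_univ_ne_zero.2 hμ) ℕ
  choose C hCm hCδ hCε using fun k : ℕ => exists_cesaroLimit_lt M h0 μ
    (ε := ((k : ℝ≥0∞) + 1)⁻¹) (by simp) (hδ k).ne'
  refine ⟨⋂ k, C k, MeasurableSet.iInter hCm, fun hB => ?_, fun ε hε => ?_⟩
  · have hcompl : μ (⋂ k, C k)ᶜ < μ univ := by
      rw [compl_iInter]
      exact (measure_iUnion_le _).trans_lt
        ((ENNReal.tsum_le_tsum fun k => (hCδ k).le).trans_lt hδsum)
    have := measure_add_measure_compl (μ := μ) (MeasurableSet.iInter hCm)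
    rw [hB, zero_add] at this
    exact hcompl.ne this
  · by_contra! hcon
    obtain ⟨k, hk⟩ := ENNReal.exists_inv_nat_lt hε
    have h1 : ε ≤ cesaroLimit M (C k) :=
      (le_cesaroLimit M hcon).trans (cesaroLimit_mono M (iInter_subset _ _))
    have h2 : ((k : ℝ≥0∞) + 1)⁻¹ ≤ (k : ℝ≥0∞)⁻¹ := ENNReal.inv_le_inv.2 le_self_add
    exact absurd (h1.trans (hCε k).le) (not_le.2 (h2.trans_lt hk))

end CesaroLimit

/-! ### Weakly wandering sets -/

section WanderingSet

variable {X : Type*} [MeasurableSpace X] {μ : Measure X}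

theorem measurable_coe (T : Nonsingular μ) : Measurable (T : Equiv.Perm X) :=
  T.2.1.measurable

/-- A nonsingular transformation as a measurable equivalence. -/
def toMeasurableEquiv (T : Nonsingular μ) : X ≃ᵐ X where
  toEquiv := (T : Equiv.Perm X)
  measurable_toFun := T.2.1.measurable
  measurable_invFun := T.2.2.measurable

/-- An invariant measure `ν ≪ μ` of an ergodic transformation is either zero or equivalent
to `μ`. -/
theorem IsErgodic.absolutelyContinuous [IsFiniteMeasure μ] {T : Nonsingular μ} (hT : IsErgodic T)
    {ν : Measure X} [IsFiniteMeasure ν] (hν : ν ≪ μ)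
    (hTν : MeasurePreserving (T : Equiv.Perm X) ν ν) (h0 : ν ≠ 0) : μ ≪ ν := by
  set f := ν.rnDeriv μ with hf_def
  have hf : Measurable f := Measure.measurable_rnDeriv ν μ
  have hνf : μ.withDensity f = ν := Measure.withDensity_rnDeriv_eq ν μ hν
  have hnull (s : Set X) : ν s = 0 ↔ μ ({x | f x ≠ 0} ∩ s) = 0 := by
    rw [← hνf]
    exact withDensity_apply_eq_zero hf
  set D : Set X := {x | f x = 0}
  have hDm : MeasurableSet D := hf (measurableSet_singleton 0)
  have hDν : ν D = 0 := by
    rw [hnull]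
    convert measure_empty (μ := μ)
    ext x
    simp [D]
  have hinv : (T : Equiv.Perm X) ⁻¹' D =ᵐ[μ] D := by
    have h1 : μ ({x | f x ≠ 0} ∩ (T : Equiv.Perm X) ⁻¹' D) = 0 := by
      rw [← hnull, hTν.measure_preimage hDm.nullMeasurableSet, hDν]
    have h2 : μ ({x | f x ≠ 0} ∩ (T : Equiv.Perm X) '' D) = 0 := by
      rw [← hnull]
      have := hTν.measure_preimage
        ((toMeasurableEquiv T).measurableSet_image.2 hDm).nullMeasurableSet
      change ν ((T : Equiv.Perm X) ⁻¹' ((T : Equiv.Perm X) '' D)) =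
        ν ((T : Equiv.Perm X) '' D) at this
      rw [← this, Equiv.preimage_image, hDν]
    have h3 := T.2.1.preimage_null h2
    filter_upwards [measure_eq_zero_iff_ae_notMem.1 h1, measure_eq_zero_iff_ae_notMem.1 h3]
      with x hx1 hx3
    refine propext ⟨fun hx => ?_, fun hx => ?_⟩
    · by_contra hxD
      exact hx1 ⟨hxD, hx⟩
    · by_contra hxD
      exact hx3 ⟨hxD, mem_image_of_mem _ hx⟩
  rcases QuasiErgodic.ae_empty_or_univ₀ hT hDm.nullMeasurableSet hinv with h | h
  · refine Measure.AbsolutelyContinuous.mk fun s _ hs => ?_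
    rw [hnull] at hs
    have hD : μ D = 0 := by rw [measure_congr h, measure_empty]
    refine measure_mono_null (fun x hx => ?_) (measure_union_null hs hD)
    by_cases hxD : f x = 0
    · exact Or.inr hxD
    · exact Or.inl ⟨hxD, hx⟩
  · refine absurd (Measure.measure_univ_eq_zero.1 ?_) h0
    rw [← hDν]
    exact measure_congr (hν.ae_le h.symm)

/-- A finite invariant measure and an infinite one cannot coexist: their Radon–Nikodym derivative
would be an invariant function, hence constant. -/
theorem IsErgodic.measure_univ_ne_top {T : Nonsingular μ} (hT : IsErgodic T) {m ν : Measure X}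
    (hm : IsInvariantMeasure T m) [IsFiniteMeasure ν] (hν : ν ≪ μ)
    (hTν : MeasurePreserving (T : Equiv.Perm X) ν ν) (h0 : ν ≠ 0) : m univ ≠ ⊤ := by
  have := hm.sigmaFinite
  have hνm : ν ≪ m := hν.trans hm.abs_cont'
  have hcomp : ν.rnDeriv m ∘ (T : Equiv.Perm X) =ᵐ[m] ν.rnDeriv m := by
    have := (toMeasurableEquiv T).measurableEmbedding.rnDeriv_map ν m
    change (fun x => (ν.map (T : Equiv.Perm X)).rnDeriv (m.map (T : Equiv.Perm X))
      ((T : Equiv.Perm X) x)) =ᵐ[m] _ at this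
    rwa [hTν.map_eq, hm.invariant.map_eq] at this
  obtain ⟨c, hc⟩ := QuasiErgodic.ae_eq_const_of_ae_eq_comp_ae hT
    (Measure.measurable_rnDeriv ν m).aestronglyMeasurable (hm.abs_cont'.ae_le hcomp)
  have hνc : ν = c • m := by
    rw [← withDensity_const, ← Measure.withDensity_rnDeriv_eq ν m hνm]
    exact withDensity_congr_ae (hm.abs_cont.ae_le hc)
  intro htop
  have hfin : ν univ ≠ ⊤ := measure_ne_top ν univ
  have hc0 : c ≠ 0 := by
    rintro rfl
    exact h0 (by rw [hνc, zero_smul])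
  rw [hνc, Measure.smul_apply, htop, smul_eq_mul, ENNReal.mul_top hc0] at hfin
  exact hfin rfl

/-- In type II_∞ or III there is a set of positive measure whose translates become arbitrarily
small, since otherwise the Cesàro limit of the translates of `μ` would have a nonzero countably
additive part, that is, a finite invariant measure equivalent to `μ`. -/
theorem IsErgodic.exists_measure_preimage_lt [IsProbabilityMeasure μ] {T : Nonsingular μ}
    (hT : IsErgodic T) (htype : IsTypeIIInfinite T ∨ IsTypeIII T) :
    ∃ B, MeasurableSet B ∧ μ B ≠ 0 ∧
      ∀ ε : ℝ≥0∞, ε ≠ 0 → ∃ n : ℕ, μ (((T : Equiv.Perm X) ^ n) ⁻¹' B) < ε := by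
  let M : ℕ → Measure X := fun n => μ.map ((T : Equiv.Perm X) ^ n : Equiv.Perm X)
  have hqmp (n : ℕ) : Measure.QuasiMeasurePreserving ((T : Equiv.Perm X) ^ n : Equiv.Perm X) μ μ :=
    (T ^ n).2.1
  have hprob (n : ℕ) : IsProbabilityMeasure (M n) :=
    Measure.isProbabilityMeasure_map (hqmp n).measurable.aemeasurable
  have happly (n : ℕ) (s : Set X) : M n s = μ (((T : Equiv.Perm X) ^ n : Equiv.Perm X) ⁻¹' s) :=
    MeasurableEquiv.map_apply (toMeasurableEquiv (T ^ n)) s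
  have hshift (n : ℕ) (s : Set X) : M n ((T : Equiv.Perm X) ⁻¹' s) = M (n + 1) s := by
    rw [happly, happly, pow_succ']
    rfl
  have hzero : cesaroMeasure M univ = 0 := by
    by_contra hne
    have hfin := isFiniteMeasure_cesaroMeasure M
    have hac : cesaroMeasure M ≪ μ :=
      cesaroMeasure_absolutelyContinuous M fun n => (hqmp n).absolutelyContinuous
    have hinv := measurePreserving_cesaroMeasure M (measurable_coe T) hshift
    have hne' : cesaroMeasure M ≠ 0 := fun h => hne (by rw [h]; rfl)
    rcases htype with ⟨m, hm, htop⟩ | h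
    · exact hT.measure_univ_ne_top hm hac hinv hne' htop
    · exact h ⟨cesaroMeasure M, inferInstance, hac, hT.absolutelyContinuous hac hinv hne', hinv⟩
  obtain ⟨B, hBm, hB, hlt⟩ := exists_measure_lt_of_cesaroMeasure_eq_zero M hzero μ
    (IsProbabilityMeasure.ne_zero μ)
  refine ⟨B, hBm, hB, fun ε hε => ?_⟩
  obtain ⟨n, hn⟩ := hlt ε hε
  exact ⟨n, (happly n B) ▸ hn⟩

theorem tendsto_measure_preimage_zero [IsFiniteMeasure μ] {ι : Type*} {l : Filter ι}
    {s : ι → Set X} (h : Tendsto (fun i => μ (s i)) l (𝓝 0)) (S : Nonsingular μ) :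
    Tendsto (fun i => μ ((S : Equiv.Perm X) ⁻¹' s i)) l (𝓝 0) := by
  have := Measure.isFiniteMeasure_map μ (S : Equiv.Perm X)
  have hac : μ.map (S : Equiv.Perm X) ≪ μ := S.2.1.absolutelyContinuous
  have := tendsto_setLIntegral_zero (μ := μ) (f := (μ.map (S : Equiv.Perm X)).rnDeriv μ)
    (Measure.lintegral_rnDeriv_lt_top _ _).ne h
  simp only [Measure.setLIntegral_rnDeriv hac] at this
  exact this.congr fun i => MeasurableEquiv.map_apply (toMeasurableEquiv S) (s i)

/-- A set whose translates become arbitrarily small contains a weakly wandering set: remove from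
it its own translates by the differences of a sufficiently sparse sequence of exponents. -/
theorem exists_weaklyWandering [IsFiniteMeasure μ] (T : Nonsingular μ) {B : Set X}
    (hBm : MeasurableSet B) (hB : μ B ≠ 0)
    (hsmall : ∀ ε : ℝ≥0∞, ε ≠ 0 → ∃ n : ℕ, μ (((T : Equiv.Perm X) ^ n) ⁻¹' B) < ε) :
    ∃ (W : Set X) (n : ℕ → ℤ), MeasurableSet W ∧ μ W ≠ 0 ∧
      ∀ i j, ∀ w ∈ W, ∀ w' ∈ W,
        ((T : Equiv.Perm X) ^ n i) w = ((T : Equiv.Perm X) ^ n j) w' → i = j := by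
  obtain ⟨ε, hε, hεsum⟩ := ENNReal.exists_pos_sum_of_countable' hB (ℕ × ℕ)
  let l : Filter ℕ := comap (fun n : ℕ => μ (((T : Equiv.Perm X) ^ n) ⁻¹' B)) (𝓝 0)
  have hl : l.NeBot := by
    rw [comap_neBot_iff]
    intro t ht
    obtain ⟨δ, hδ, hδt⟩ := ENNReal.nhds_zero_basis.mem_iff.1 ht
    obtain ⟨n, hn⟩ := hsmall δ hδ.ne'
    exact ⟨n, hδt hn⟩
  have hlim (a : ℤ) :
      Tendsto (fun n : ℕ => μ (((T : Equiv.Perm X) ^ ((n : ℤ) - a)) ⁻¹' B)) l (𝓝 0) := by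
    refine (tendsto_measure_preimage_zero (μ := μ) tendsto_comap (T ^ (-a))).congr fun n => ?_
    rw [← preimage_comp, ← Equiv.Perm.coe_mul, Subgroup.coe_zpow, ← zpow_natCast, ← zpow_add,
      sub_eq_add_neg]
  -- The first component of a pair records a position in the sequence, to choose tolerances by.
  obtain ⟨f, -, hf⟩ := exists_seq_of_forall_finset_exists (fun _ : ℕ × ℤ => True)
    (fun p q => p.1 < q.1 ∧
      μ (((T : Equiv.Perm X) ^ (q.2 - p.2)) ⁻¹' B) < ε (p.1, q.1)) (by
    intro s _
    obtain ⟨j, hj⟩ := (s.image Prod.fst).exists_nat_subset_range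
    have hev : ∀ᶠ n : ℕ in l, ∀ p ∈ s,
        μ (((T : Equiv.Perm X) ^ ((n : ℤ) - p.2)) ⁻¹' B) < ε (p.1, j) :=
      (Filter.eventually_all_finset s).2 fun p _ =>
        (hlim p.2).eventually (gt_mem_nhds (hε _))
    obtain ⟨n, hn⟩ := hev.exists
    refine ⟨(j, n), trivial, fun p hp => ⟨?_, hn p hp⟩⟩
    exact Finset.mem_range.1 (hj (Finset.mem_image_of_mem _ hp)))
  have hmono : StrictMono fun i => (f i).1 := fun i j hij => (hf i j hij).1
  let bad : ℕ × ℕ → Set X := fun p =>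
    if p.1 < p.2 then ((T : Equiv.Perm X) ^ ((f p.2).2 - (f p.1).2)) ⁻¹' B else ∅
  have hbadm (p : ℕ × ℕ) : MeasurableSet (bad p) := by
    by_cases h : p.1 < p.2
    · simp only [bad, if_pos h]
      exact measurable_coe (T ^ ((f p.2).2 - (f p.1).2)) hBm
    · simp only [bad, if_neg h, MeasurableSet.empty]
  have hbad : μ (⋃ p, bad p) < μ B := by
    refine (measure_iUnion_le _).trans_lt (lt_of_le_of_lt ?_ hεsum)
    calc ∑' p, μ (bad p) ≤ ∑' p : ℕ × ℕ, ε ((f p.1).1, (f p.2).1) := by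
          refine ENNReal.tsum_le_tsum fun p => ?_
          by_cases h : p.1 < p.2
          · simp only [bad, if_pos h]
            exact (hf _ _ h).2.le
          · simp [bad, if_neg h]
      _ ≤ ∑' p, ε p := ENNReal.tsum_comp_le_tsum_of_injective
          (f := fun p : ℕ × ℕ => ((f p.1).1, (f p.2).1))
          (hmono.injective.prodMap hmono.injective) ε
  have key : ∀ i j, i < j → ∀ w ∈ B \ ⋃ p, bad p, ∀ w' ∈ B \ ⋃ p, bad p,
      ((T : Equiv.Perm X) ^ (f i).2) w' ≠ ((T : Equiv.Perm X) ^ (f j).2) w := by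
    intro i j hij w hw w' hw' heq
    refine hw.2 (mem_iUnion.2 ⟨(i, j), ?_⟩)
    simp only [bad, if_pos hij, mem_preimage]
    rw [sub_eq_neg_add, zpow_add, Equiv.Perm.mul_apply, ← heq, ← Equiv.Perm.mul_apply, ← zpow_add,
      neg_add_cancel, zpow_zero]
    exact hw'.1
  refine ⟨B \ ⋃ p, bad p, fun i => (f i).2, hBm.diff (.iUnion hbadm), fun h0 => ?_, ?_⟩
  · have := le_measure_sdiff (μ := μ) (s₁ := B) (s₂ := ⋃ p, bad p)
    rw [h0] at this
    exact absurd hbad (not_lt.2 (tsub_eq_zero_iff_le.1 (le_antisymm this zero_le)))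
  · intro i j w hw w' hw' heq
    rcases lt_trichotomy i j with h | h | h
    · exact absurd heq (key i j h w' hw' w hw)
    · exact h
    · exact absurd heq.symm (key j i h w hw w' hw')

end WanderingSet

/-! ### Countable groups of nonsingular transformations -/

section CountableSubgroup

variable {X : Type*} [MeasurableSpace X] {μ : Measure X}

/-- A measurable permutation that moves every point inside its orbit under a countable group of
nonsingular transformations is nonsingular. -/
theorem mem_nonsingular_of_forall_exists [StandardBorelSpace X] {Γ : Subgroup (Nonsingular μ)}
    [Countable Γ] {f : Equiv.Perm X} (hf : Measurable f)
    (h : ∀ x, ∃ S ∈ Γ, f x = (S : Equiv.Perm X) x) : f ∈ Nonsingular μ := by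
  have hemb : MeasurableEmbedding f := hf.measurableEmbedding f.injective
  have hinv : Measurable (f⁻¹ : Equiv.Perm X) := fun s hs => by
    have := hemb.measurableSet_image.2 hs
    rwa [Equiv.image_eq_preimage_symm] at this
  refine ⟨⟨hf, .mk fun s hs h0 => ?_⟩, ⟨hinv, .mk fun s hs h0 => ?_⟩⟩
  · rw [Measure.map_apply hf hs]
    refine measure_mono_null (t := ⋃ S : Γ, ((S : Nonsingular μ) : Equiv.Perm X) ⁻¹' s)
      (fun x hx => ?_) (measure_iUnion_null fun S => (S : Nonsingular μ).2.1.preimage_null h0)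
    obtain ⟨S, hS, hSx⟩ := h x
    exact mem_iUnion.2 ⟨⟨S, hS⟩, by rwa [mem_preimage, ← hSx]⟩
  · rw [Measure.map_apply hinv hs]
    refine measure_mono_null
      (t := ⋃ S : Γ, (((S : Nonsingular μ) : Equiv.Perm X)⁻¹ : Equiv.Perm X) ⁻¹' s)
      (fun x hx => ?_) (measure_iUnion_null fun S => (S : Nonsingular μ).2.2.preimage_null h0)
    obtain ⟨S, hS, hSx⟩ := h ((f⁻¹ : Equiv.Perm X) x)
    refine mem_iUnion.2 ⟨⟨S, hS⟩, ?_⟩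
    have hx' : (S : Equiv.Perm X)⁻¹ x = (f⁻¹ : Equiv.Perm X) x := by
      rw [Equiv.Perm.inv_eq_iff_eq, ← hSx]
      exact (Equiv.apply_symm_apply f x).symm
    rwa [mem_preimage, hx']

/-- Every conull set contains a conull Borel set invariant under a given countable group. -/
theorem exists_invariant_of_ae (Γ : Subgroup (Nonsingular μ)) [Countable Γ] {p : X → Prop}
    (hp : ∀ᵐ x ∂μ, p x) :
    ∃ Y : Set X, MeasurableSet Y ∧ (∀ᵐ x ∂μ, x ∈ Y) ∧ (∀ x ∈ Y, p x) ∧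
      ∀ S ∈ Γ, ∀ x, (S : Equiv.Perm X) x ∈ Y ↔ x ∈ Y := by
  obtain ⟨N, hNp, hNm, hN0⟩ := exists_measurable_superset_of_null hp
  have hdir {S : Nonsingular μ} (hS : S ∈ Γ) {x : X}
      (hx : x ∈ ⋂ S : Γ, ((S : Nonsingular μ) : Equiv.Perm X) ⁻¹' Nᶜ) :
      (S : Equiv.Perm X) x ∈ ⋂ S : Γ, ((S : Nonsingular μ) : Equiv.Perm X) ⁻¹' Nᶜ := by
    rw [mem_iInter] at hx ⊢
    exact fun S' => hx ⟨(S' : Nonsingular μ) * S, Γ.mul_mem S'.2 hS⟩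
  refine ⟨⋂ S : Γ, ((S : Nonsingular μ) : Equiv.Perm X) ⁻¹' Nᶜ,
    .iInter fun S => measurable_coe (S : Nonsingular μ) hNm.compl, ?_, fun x hx => ?_,
    fun S hS x => ⟨fun hx => ?_, hdir hS⟩⟩
  · simp only [mem_iInter, ae_all_iff]
    exact fun S => (S : Nonsingular μ).2.1.ae (measure_eq_zero_iff_ae_notMem.1 hN0)
  · by_contra hpx
    exact mem_iInter.1 hx 1 (hNp hpx)
  · have := hdir (Γ.inv_mem hS) hx
    rw [Subgroup.coe_inv] at this
    exact Equiv.symm_apply_apply (S : Equiv.Perm X) x ▸ this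

end CountableSubgroup

/-! ### Splitting the space along orbits -/

section Splitting

/-- A Borel Schröder–Bernstein argument for the pair of injections `φ : Y × G → Y` and
`y ↦ (y, g₀)`. The bijection it produces moves points along any reflexive relation that `φ`
moves points along. -/
theorem exists_measurableEquiv_of_injective {Y G : Type*} [MeasurableSpace Y]
    [StandardBorelSpace Y] [MeasurableSpace G] [StandardBorelSpace G] (g₀ : G) {φ : Y × G → Y}
    (hφ : Measurable φ) (hinj : Function.Injective φ) {R : Y → Y → Prop} (hrefl : ∀ y, R y y)
    (hR : ∀ p, R p.1 (φ p)) : ∃ e : Y × G ≃ᵐ Y, ∀ p, R p.1 (e p) := by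
  classical
  let f : Y → Y := fun y => φ (y, g₀)
  have hf : MeasurableEmbedding f := (hφ.comp (by fun_prop : Measurable fun y => (y, g₀)))
    |>.measurableEmbedding fun a b hab => (Prod.ext_iff.1 (hinj hab)).1
  -- The points whose chain of preimages under `f` leaves the range of `φ`.
  let A : Set Y := ⋃ k : ℕ, f^[k] '' (range φ)ᶜ
  have hrange : MeasurableSet (range φ) := (hφ.measurableEmbedding hinj).measurableSet_range
  have hA : MeasurableSet A := by
    refine .iUnion fun k => ?_
    induction k with
    | zero => simpa using hrange.compl
    | succ k ih =>
      rw [Function.iterate_succ', image_comp]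
      exact hf.measurableSet_image.2 ih
  have hfA {y : Y} (hy : y ∈ A) : f y ∈ A := by
    obtain ⟨k, z, hz, rfl⟩ := mem_iUnion.1 hy
    exact mem_iUnion.2 ⟨k + 1, z, hz, Function.iterate_succ_apply' f k z⟩
  have hAf {p : Y × G} (hp : φ p ∈ A) : p.2 = g₀ ∧ p.1 ∈ A := by
    obtain ⟨k, z, hz, hzp⟩ := mem_iUnion.1 hp
    cases k with
    | zero => exact absurd ⟨p, hzp.symm⟩ hz
    | succ k =>
      rw [Function.iterate_succ_apply'] at hzp
      rw [← hinj hzp]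
      exact ⟨rfl, mem_iUnion.2 ⟨k, z, hz, rfl⟩⟩
  let s : Set (Y × G) := {p | p.2 = g₀ ∧ p.1 ∈ A}
  have hs : MeasurableSet s :=
    (measurable_snd (measurableSet_singleton g₀)).inter (measurable_fst hA)
  let ψ : Y × G → Y := fun p => if p ∈ s then p.1 else φ p
  have hψ : Measurable ψ := Measurable.ite hs measurable_fst hφ
  have hψinj : Function.Injective ψ := by
    intro p q hpq
    by_cases hp : p ∈ s <;> by_cases hq : q ∈ s <;> simp only [ψ, hp, hq, if_true, if_false] at hpq
    · exact Prod.ext hpq (hp.1.trans hq.1.symm)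
    · exact absurd (hAf (hpq ▸ hp.2)) hq
    · exact absurd (hAf (hpq.symm ▸ hq.2)) hp
    · exact hinj hpq
  have hψsurj : Function.Surjective ψ := by
    intro y
    by_cases hy : y ∈ A
    · exact ⟨(y, g₀), if_pos ⟨rfl, hy⟩⟩
    · have hyφ : y ∈ range φ := by
        by_contra hc
        exact hy (mem_iUnion.2 ⟨0, y, hc, rfl⟩)
      obtain ⟨⟨z, g⟩, rfl⟩ := hyφ
      refine ⟨(z, g), if_neg ?_⟩
      rintro ⟨rfl, hz⟩
      exact hy (hfA hz)
  have hemb : MeasurableEmbedding ψ := hψ.measurableEmbedding hψinj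
  refine ⟨⟨Equiv.ofBijective ψ ⟨hψinj, hψsurj⟩, hψ, fun t ht => ?_⟩, fun p => ?_⟩
  · have := hemb.measurableSet_image.2 ht
    change MeasurableSet ((Equiv.ofBijective ψ ⟨hψinj, hψsurj⟩) '' t) at this
    rwa [Equiv.image_eq_preimage_symm] at this
  · change R p.1 (ψ p)
    by_cases hp : p ∈ s
    · simpa only [ψ, hp, if_true] using hrefl p.1
    · simpa only [ψ, hp, if_false] using hR p

/-- If an invariant Borel set `Y` is covered by the translates of a weakly wandering set `W`, then
`Y × G` and `Y` are in Borel bijection along the orbits of `T`, for every countable `G`: the point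
`T ^ k w` of the copy of `Y` labelled `g` is sent into a translate of `W` reserved for `(k, g)`. -/
theorem exists_measurableEquiv_prod {X : Type*} [MeasurableSpace X] [StandardBorelSpace X]
    {μ : Measure X} (T : Nonsingular μ) {W : Set X} {n : ℕ → ℤ} (hWm : MeasurableSet W)
    (hW : ∀ i j, ∀ w ∈ W, ∀ w' ∈ W,
      ((T : Equiv.Perm X) ^ n i) w = ((T : Equiv.Perm X) ^ n j) w' → i = j)
    {Y : Set X} (hYm : MeasurableSet Y) (hYT : ∀ (k : ℤ) (x : X), x ∈ Y →
      ((T : Equiv.Perm X) ^ k) x ∈ Y)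
    (hYW : ∀ x ∈ Y, ∃ k : ℤ, ((T : Equiv.Perm X) ^ k) x ∈ W)
    (G : Type*) [MeasurableSpace G] [DiscreteMeasurableSpace G] [Countable G] [Nonempty G] :
    ∃ e : Y × G ≃ᵐ Y, ∀ p, ∃ k : ℤ, (e p : X) = ((T : Equiv.Perm X) ^ k) (p.1 : X) := by
  classical
  have := hYm.standardBorel
  have hTm (k : ℤ) : Measurable ((T : Equiv.Perm X) ^ k : Equiv.Perm X) := measurable_coe (T ^ k)
  have hex (y : Y) :
      ∃ i : ℕ, ((T : Equiv.Perm X) ^ (Equiv.intEquivNat.symm i)) (y : X) ∈ W := by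
    obtain ⟨k, hk⟩ := hYW y y.2
    exact ⟨Equiv.intEquivNat k, by simpa using hk⟩
  let d : Y → ℕ := fun y => Nat.find (hex y)
  have hd : Measurable d :=
    measurable_find hex fun i => ((hTm _).comp measurable_subtype_coe) hWm
  have hdW (y : Y) : ((T : Equiv.Perm X) ^ (Equiv.intEquivNat.symm (d y))) (y : X) ∈ W :=
    Nat.find_spec (hex y)
  obtain ⟨ι, hι⟩ := exists_injective_nat (ℕ × G)
  let F : ℕ → G → Y → Y := fun i g y =>
    ⟨((T : Equiv.Perm X) ^ n (ι (i, g))) (((T : Equiv.Perm X) ^ (Equiv.intEquivNat.symm i)) y),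
      hYT _ _ (hYT _ _ y.2)⟩
  have hF (i : ℕ) (g : G) : Measurable (F i g) :=
    (((hTm _).comp (hTm _)).comp measurable_subtype_coe).subtype_mk
  refine exists_measurableEquiv_of_injective (Classical.arbitrary G)
    (φ := fun p => F (d p.1) p.2 p.1)
    (R := fun y z => ∃ k : ℤ, (z : X) = ((T : Equiv.Perm X) ^ k) (y : X))
    ?_ ?_ (fun y => ⟨0, by simp⟩) fun p => ⟨n (ι (d p.1, p.2)) + Equiv.intEquivNat.symm (d p.1), by
      rw [zpow_add, Equiv.Perm.mul_apply]⟩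
  · refine measurable_from_prod_countable_left fun g => ?_
    have h : Measurable fun q : Y × ℕ => F q.2 g q.1 :=
      measurable_from_prod_countable_left fun i => hF i g
    exact h.comp (measurable_id.prodMk hd)
  · rintro ⟨y, g⟩ ⟨y', g'⟩ h
    have h' := congrArg Subtype.val h
    have h1 := hι (hW _ _ _ (hdW y) _ (hdW y') h')
    obtain ⟨hdd, hgg⟩ := Prod.ext_iff.1 h1
    simp only at hdd hgg
    subst hgg
    simp only [F, ← hdd] at h'
    exact Prod.ext (Subtype.ext ((Equiv.injective _) ((Equiv.injective _) h'))) rfl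

end Splitting

/-! ### Translation actions transported to a subset -/

section LiftedAction

variable {X G : Type*} [Group G]

/-- Given a bijection `k : Y × G ≃ Y` of a subset `Y` of `X`, the action of `G` on `X` that is
left translation of the second coordinate of `Y × G` on `Y`, and trivial off `Y`. -/
noncomputable def translationAction {Y : Set X} (k : Y × G ≃ Y) : G →* Equiv.Perm X :=
  letI := Classical.decPred (· ∈ Y)
  Equiv.Perm.ofSubtype.comp <| (Equiv.permCongrHom k).toMonoidHom.comp
    { toFun := fun g => Equiv.prodCongr (Equiv.refl Y) (Equiv.mulLeft g)
      map_one' := by ext <;> simp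
      map_mul' := fun g h => by ext <;> simp [mul_assoc] }

theorem translationAction_apply {Y : Set X} (k : Y × G ≃ Y) (g : G) (p : Y × G) :
    translationAction k g (k p) = k (p.1, g * p.2) := by
  classical
  simp [translationAction, Equiv.permCongrHom]
  rfl

theorem translationAction_apply_of_notMem {Y : Set X} (k : Y × G ≃ Y) (g : G) {x : X}
    (hx : x ∉ Y) : translationAction k g x = x := by
  classical
  exact Equiv.Perm.ofSubtype_apply_of_not_mem _ hx

theorem measurable_translationAction [MeasurableSpace X] [MeasurableSpace G]
    [DiscreteMeasurableSpace G] {Y : Set X} (hY : MeasurableSet Y) (k : Y × G ≃ᵐ Y) (g : G) :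
    Measurable (translationAction k.toEquiv g) := by
  refine measurable_of_restrict_of_restrict_compl hY ?_ ?_
  · have : Y.domRestrict (translationAction k.toEquiv g) =
        fun y => (k ((k.symm y).1, g * (k.symm y).2) : X) := by
      funext y
      have := translationAction_apply k.toEquiv g (k.symm y)
      simpa using this
    rw [this]
    refine measurable_subtype_coe.comp (k.measurable.comp (.prodMk ?_ ?_))
    · exact measurable_fst.comp k.symm.measurable
    · exact (Measurable.of_discrete (f := fun h : G => g * h)).comp
        (measurable_snd.comp k.symm.measurable)
  · have : Yᶜ.domRestrict (translationAction k.toEquiv g) =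
        ((↑) : (Yᶜ : Set X) → X) := by
      funext y
      exact translationAction_apply_of_notMem _ g y.2
    rw [this]
    exact measurable_subtype_coe

end LiftedAction

/-! ### Straightening cocycle crossed actions -/

section Assembly

variable {X : Type*} [MeasurableSpace X] {μ : Measure X}

theorem mk_mem_fullGroup_iff {T S : Nonsingular μ} :
    (QuotientGroup.mk S : Aut μ) ∈ fullGroup T ↔ S ∈ orbitPreserving T := by
  refine ⟨?_, fun h => Subgroup.mem_map_of_mem _ h⟩
  rintro ⟨R, hR, hRS⟩
  have hRS' : R⁻¹ * S ∈ aeTrivial μ := QuotientGroup.eq.1 hRS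
  have htriv : R⁻¹ * S ∈ orbitPreserving T := by
    have : ∀ᵐ x ∂μ, ((R⁻¹ * S : Nonsingular μ) : Equiv.Perm X) x = x := hRS'
    filter_upwards [this] with x hx
    exact ⟨0, by rw [hx, zpow_zero, Equiv.Perm.one_apply]⟩
  simpa using (orbitPreserving T).mul_mem hR htriv

theorem zpow_mem_orbitPreserving (T : Nonsingular μ) (k : ℤ) : T ^ k ∈ orbitPreserving T := by
  change ∀ᵐ x ∂μ, ∃ n : ℤ, ((T ^ k : Nonsingular μ) : Equiv.Perm X) x = ((T : Equiv.Perm X) ^ n) x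
  exact Eventually.of_forall fun _ => ⟨k, by rw [Subgroup.coe_zpow]⟩

/-- For an ergodic transformation of type II_∞ or III, any countable subgroup `Γ` of the
nonsingular group that contains `T`, and any countable `G`, there is a conull `Γ`-invariant Borel
set `Y` such that `Y` and `Y × G` are in Borel bijection along the orbits of `T`. -/
theorem IsErgodic.exists_measurableEquiv_prod [StandardBorelSpace X] [IsProbabilityMeasure μ]
    {T : Nonsingular μ} (hT : IsErgodic T) (htype : IsTypeIIInfinite T ∨ IsTypeIII T)
    {Γ : Subgroup (Nonsingular μ)} [Countable Γ] (hTΓ : T ∈ Γ)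
    (G : Type*) [MeasurableSpace G] [DiscreteMeasurableSpace G] [Countable G] [Nonempty G] :
    ∃ Y : Set X, MeasurableSet Y ∧ (∀ᵐ x ∂μ, x ∈ Y) ∧
      (∀ S ∈ Γ, ∀ x, (S : Equiv.Perm X) x ∈ Y ↔ x ∈ Y) ∧
      ∃ e : Y × G ≃ᵐ Y, ∀ p, ∃ k : ℤ, (e p : X) = ((T : Equiv.Perm X) ^ k) (p.1 : X) := by
  obtain ⟨B, hBm, hB, hsmall⟩ := hT.exists_measure_preimage_lt htype
  obtain ⟨W, n, hWm, hW, hdisj⟩ := exists_weaklyWandering T hBm hB hsmall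
  have hcover : ∀ᵐ x ∂μ, ∃ k : ℤ, ((T : Equiv.Perm X) ^ k) x ∈ W := by
    have hinv : (T : Equiv.Perm X) ⁻¹' {x | ∃ k : ℤ, ((T : Equiv.Perm X) ^ k) x ∈ W} =
        {x | ∃ k : ℤ, ((T : Equiv.Perm X) ^ k) x ∈ W} := by
      ext x
      constructor
      · rintro ⟨k, hk⟩
        exact ⟨k + 1, by rwa [zpow_add_one, Equiv.Perm.mul_apply]⟩
      · rintro ⟨k, hk⟩
        refine ⟨k - 1, ?_⟩
        rwa [← Equiv.Perm.mul_apply, ← zpow_add_one, sub_add_cancel]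
    have hmeas : MeasurableSet {x | ∃ k : ℤ, ((T : Equiv.Perm X) ^ k) x ∈ W} := by
      rw [ofPred_exists]
      exact .iUnion fun k => measurable_coe (T ^ k) hWm
    rcases PreErgodic.ae_empty_or_univ hT.toPreErgodic hmeas hinv with h | h
    · refine absurd (measure_mono_null (fun x hx => ?_) (ae_eq_empty.1 h)) hW
      exact ⟨0, by simpa using hx⟩
    · filter_upwards [h.mem_iff] with x hx
      exact hx.2 (mem_univ x)
  obtain ⟨Y, hYm, hY, hYW, hYΓ⟩ := exists_invariant_of_ae Γ hcover
  refine ⟨Y, hYm, hY, hYΓ, FullGroup.exists_measurableEquiv_prod T hWm hdisj hYm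
    (fun k x hx => ?_) hYW G⟩
  exact (hYΓ (T ^ k) (Γ.zpow_mem hTΓ k) x).2 hx

/-- A cocycle crossed action agrees modulo `[T]` with a genuine homomorphism. If `e` is a bijection
of `Y × G` with a conull set `Y` along the orbits of `T`, then `(y, h) ↦ e (γ_h y, h)` conjugates
left translation by `g` on `Y × G` into a transformation which agrees with `γ_g` modulo `[T]`,
because `γ_{gh} γ_h⁻¹ γ_g⁻¹ = c(g, h)⁻¹` lies in `[T]`. -/
theorem IsCocycleCrossedAction.exists_hom [StandardBorelSpace X] [IsProbabilityMeasure μ]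
    {T : Nonsingular μ} (hT : IsErgodic T) (htype : IsTypeIIInfinite T ∨ IsTypeIII T)
    {G : Type*} [Group G] [Countable G] {γ : G → Aut μ} {c : G → G → Aut μ}
    (hγ : IsCocycleCrossedAction T γ c) :
    ∃ σ : G →* Aut μ, ∀ g, σ g * (γ g)⁻¹ ∈ fullGroup T := by
  let _ : MeasurableSpace G := ⊤
  have : DiscreteMeasurableSpace G := ⟨fun _ => trivial⟩
  choose r hr using fun g => QuotientGroup.mk_surjective (γ g)
  let q : FreeGroup (Option G) →* Nonsingular μ :=
    FreeGroup.lift fun o => o.elim T r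
  have : Countable (FreeGroup (Option G)) := Quot.mk_surjective.countable
  have : Countable q.range := (MonoidHom.rangeRestrict_surjective q).countable
  have hTΓ : T ∈ q.range := ⟨FreeGroup.of none, by simp [q]⟩
  have hrΓ (g : G) : r g ∈ q.range := ⟨FreeGroup.of (some g), by simp [q]⟩
  obtain ⟨Y, hYm, hY, hYΓ, e, he⟩ := hT.exists_measurableEquiv_prod htype hTΓ G
  let ρ : G → Equiv.Perm Y := fun g =>
    (r g : Equiv.Perm X).subtypePerm fun x => hYΓ (r g) (hrΓ g) x
  have hρ (g : G) : Measurable (ρ g) :=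
    ((measurable_coe (r g)).comp measurable_subtype_coe).subtype_mk
  have hρ' (g : G) : Measurable (ρ g).symm :=
    ((measurable_coe (r g)⁻¹).comp measurable_subtype_coe).subtype_mk
  let θ : Y × G ≃ᵐ Y × G :=
    { toFun := fun p => (ρ p.2 p.1, p.2)
      invFun := fun p => ((ρ p.2).symm p.1, p.2)
      left_inv := fun p => by simp
      right_inv := fun p => by simp
      measurable_toFun := measurable_from_prod_countable_left fun g =>
        (hρ g).prodMk measurable_const
      measurable_invFun := measurable_from_prod_countable_left fun g =>
        (hρ' g).prodMk measurable_const }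
  let k : Y × G ≃ᵐ Y := θ.trans e
  have hk (p : Y × G) : ∃ j : ℤ,
      (k p : X) = ((T : Equiv.Perm X) ^ j) ((r p.2 : Equiv.Perm X) p.1) := he (θ p)
  let Q : G → G → ℤ → Nonsingular μ := fun g h j => r (g * h) * (r h)⁻¹ * T ^ (-j)
  -- At each point of `Y`, `translationAction k g` agrees with some `T ^ i * Q g h j`.
  have hQ (g : G) (x : X) (hx : x ∈ Y) : ∃ (h : G) (i j : ℤ),
      translationAction k.toEquiv g x = ((T ^ i * Q g h j : Nonsingular μ) : Equiv.Perm X) x := by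
    obtain ⟨⟨y, h⟩, hp⟩ := k.surjective ⟨x, hx⟩
    obtain ⟨j, hj⟩ := hk (y, h)
    obtain ⟨i, hi⟩ := hk (y, g * h)
    refine ⟨h, i, j, ?_⟩
    have hxk : x = (k (y, h) : X) := (congrArg Subtype.val hp).symm
    rw [hxk, show translationAction k.toEquiv g (k (y, h)) = k (y, g * h) from
      translationAction_apply k.toEquiv g (y, h), hi, hj]
    simp [Q, Equiv.Perm.mul_apply]
  have hσ (g : G) : translationAction k.toEquiv g ∈ Nonsingular μ := by
    refine mem_nonsingular_of_forall_exists (Γ := q.range)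
      (measurable_translationAction hYm k g) fun x => ?_
    by_cases hx : x ∈ Y
    · obtain ⟨h, i, j, hij⟩ := hQ g x hx
      exact ⟨_, mul_mem (zpow_mem hTΓ i) (mul_mem (mul_mem (hrΓ _) (inv_mem (hrΓ h)))
        (zpow_mem hTΓ (-j))), hij⟩
    · exact ⟨1, one_mem _, translationAction_apply_of_notMem _ g hx⟩
  let σ : G →* Nonsingular μ := (translationAction k.toEquiv).codRestrict (Nonsingular μ) hσ
  have hQT (g h : G) (j : ℤ) : Q g h j * (r g)⁻¹ ∈ orbitPreserving T := by
    rw [← mk_mem_fullGroup_iff]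
    have h1 : (QuotientGroup.mk (Q g h j * (r g)⁻¹) : Aut μ) =
        (c g h)⁻¹ * (γ g * QuotientGroup.mk (T ^ (-j)) * (γ g)⁻¹) := by
      rw [eq_mul_inv_of_mul_eq (hγ.mul_eq g h).symm]
      simp only [Q, QuotientGroup.mk_mul, QuotientGroup.mk_inv, hr]
      group
    rw [h1]
    refine mul_mem (inv_mem (hγ.mem_fullGroup g h)) ?_
    exact (Subgroup.mem_normalizer_iff.1 (hγ.mem_fullNormalizer g) _).1
      (mk_mem_fullGroup_iff.2 (zpow_mem_orbitPreserving T _))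
  refine ⟨(QuotientGroup.mk' (aeTrivial μ)).comp σ, fun g => ?_⟩
  rw [← hr g]
  change (QuotientGroup.mk (σ g * (r g)⁻¹) : Aut μ) ∈ fullGroup T
  rw [mk_mem_fullGroup_iff]
  have hall : ∀ᵐ x ∂μ, ∀ (h : G) (j : ℤ), ∃ n : ℤ,
      ((Q g h j * (r g)⁻¹ : Nonsingular μ) : Equiv.Perm X) x = ((T : Equiv.Perm X) ^ n) x :=
    ae_all_iff.2 fun h => ae_all_iff.2 fun j => hQT g h j
  filter_upwards [hall, (r g)⁻¹.2.1.ae hY] with x hx hxY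
  obtain ⟨h, i, j, hij⟩ := hQ g _ hxY
  obtain ⟨n, hn⟩ := hx h j
  refine ⟨i + n, ?_⟩
  rw [zpow_add, Equiv.Perm.mul_apply, ← hn]
  exact hij

end Assembly

end FullGroup

theorem theorem4p1 {X : Type*} [MeasurableSpace X] [StandardBorelSpace X]
    (μ : MeasureTheory.Measure X) [MeasureTheory.IsProbabilityMeasure μ]
    [MeasureTheory.NullSingletonClass μ] (T : FullGroup.Nonsingular μ) (hT : FullGroup.IsErgodic T)
    (htype : FullGroup.IsTypeIIInfinite T ∨ FullGroup.IsTypeIII T)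
    {G : Type*} [Group G] [Countable G] (γ : G → FullGroup.Aut μ)
    (c : G → G → FullGroup.Aut μ) (hγ : FullGroup.IsCocycleCrossedAction T γ c) :
    ∃ u : G → FullGroup.Aut μ, FullGroup.IsNormalizedCochain T u ∧
      (∀ g h : G, FullGroup.perturbCocycle u γ c g h = 1) ∧
      FullGroup.IsAction T (FullGroup.perturbMap u γ) := by
  obtain ⟨σ, hσ⟩ := hγ.exists_hom hT htype
  have hpert : FullGroup.perturbMap (fun g => σ g * (γ g)⁻¹) γ = σ := by
    funext g
    simp [FullGroup.perturbMap]
  refine ⟨fun g => σ g * (γ g)⁻¹, ⟨hσ, ?_⟩, fun g h => ?_, ?_⟩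
  · rw [map_one, hγ.map_one, inv_one, mul_one]
  · rw [FullGroup.perturbCocycle, eq_mul_inv_of_mul_eq (hγ.mul_eq g h).symm, map_mul]
    group
  · rw [hpert]
    refine ⟨fun g => ?_, fun _ _ => one_mem _, fun g h => ?_, map_one σ, fun _ => rfl, fun _ => rfl⟩
    · rw [← inv_mul_cancel_right (σ g) (γ g)]
      exact mul_mem (Subgroup.le_normalizer (hσ g)) (hγ.mem_fullNormalizer g)
    · rw [one_mul, map_mul]
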